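/- Let $\operatorname{crank}(\lambda)$ be the crank of a partition $\lambda$: if $\mu(\lambda)$ is the number of ones in $\lambda$ and $\nu(\lambda)$ the number of parts larger than $\mu(\lambda)$, then $\operatorname{crank}(\lambda)$ is the largest part of $\lambda$ if $\mu(\lambda)=0$ (and $0$ for the empty partition), and $\nu(\lambda)-\mu(\lambda)$ if $\mu(\lambda)>0$. For $m\in\mathbb Z$ and $n\ge 0$, $n\neq 1$, let $M(m,n)$ be the number of partitions of $n$ with crank $m$; for $n=1$ use the customary convention $M(1,1)=M(-1,1)=1$, $M(0,1)=-1$ and $M(m,1)=0$ for all other $m$. For $|q|<1$ put $$(q)_\infty=\prod_{n\ge1}(1-q^n),\qquad C_k(q)=\sum_{n\ge0}\Bigl(\sum_{m\in\mathbb Z}m^kM(m,n)\Bigr)q^n,\qquad \mathcal C_k(q)=(q)_\infty C_k(q).$$ For $\tau$ in the upper half-plane, $q=e^{2\pi i\tau}$ and $k\ge1$, put $$G_{2k}(\tau)=-\frac{B_{2k}}{4k}+\sum_{n\ge1}\sigma_{2k-1}(n)q^n,$$ where $B_{2k}$ is the Bernoulli number and $\sigma_j(n)=\sum_{d\mid n}d^j$.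 For a function $\phi$ on partitions put $$\mathrm{Tr}_k(\phi;X_1,\dots,X_k)=\sum_{\lambda\vdash k}\phi(\lambda)\prod_{j=1}^kX_j^{m_j},$$ where $m_j$ is the multiplicity of $j$ in $\lambda$, and let $\ell(\lambda)=\sum_j m_j$. For $\lambda\vdash k$, $k\ge 1$, let $$\phi_M(\lambda)=(2k)!\prod_{j=1}^k\frac{2^{m_j}}{m_j!\,((2j)!)^{m_j}},\qquad \phi_S(\lambda)=\frac{(2k)!}{2}(-1)^{\ell(\lambda)-1}(\ell(\lambda)-1)!\prod_{j=1}^k\frac1{m_j!\,((2j)!)^{m_j}}.$$ Then for every integer $k\ge1$ and every $\tau$ in the upper half-plane, with $q=e^{2\pi i\tau}$, the product $(q)_\infty$ and the series $C_{2k}(q)$ and $G_{2k}(\tau)$ converge, and $$\mathcal C_{2k}(q)=\mathrm{Tr}_k\Bigl(\phi_M;\,G_2(\tau)+\frac{B_2}{4},\,G_4(\tau)+\frac{B_4}{8},\,\dots,\,G_{2k}(\tau)+\frac{B_{2k}}{4k}\Bigr),$$ $$G_{2k}(\tau)=-\frac{B_{2k}}{4k}+\mathrm{Tr}_k\bigl(\phi_S;\,\mathcal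 C_2(q),\mathcal C_4(q),\dots,\mathcal C_{2k}(q)\bigr).$$ -/

import Mathlib

namespace CrankTrace

/-- The crank of a partition. With `μ` the number of ones and `ν` the number of parts larger
than `μ`, it is the largest part if `μ = 0` and `ν - μ` if `μ > 0`. The supremum of the multiset
of parts is the largest part; it is `0` for the empty partition. -/
def crank {n : ℕ} (p : n.Partition) : ℤ :=
  if p.parts.count 1 = 0 then (p.parts.sup : ℤ)
  else (p.parts.countP (fun a => p.parts.count 1 < a) : ℤ) - (p.parts.count 1 : ℤ)

/-- `M(m, n)`: the number of partitions of `n` with crank `m`, with the customary convention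
`M(1, 1) = M(-1, 1) = 1`, `M(0, 1) = -1` for `n = 1`, which is the one for which
`∑ M(m, n) ζ ^ m q ^ n = (q)_∞ / ((ζ q)_∞ (ζ⁻¹ q)_∞)`. -/
def crankCount (m : ℤ) (n : ℕ) : ℤ :=
  if n = 1 then (if m = 0 then -1 else if m = 1 ∨ m = -1 then 1 else 0)
  else ((Finset.univ.filter (fun p : n.Partition => crank p = m)).card : ℤ)

/-- For fixed `n`, only finitely many `M(m, n)` are nonzero, so that the sum over `m` in the
crank moments is a genuine finite sum. -/
theorem crankCount_support_finite (n : ℕ) :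
    (Function.support (fun m : ℤ => crankCount m n)).Finite := by
  by_cases hn : n = 1
  · refine (Set.toFinite ({0, 1, -1} : Set ℤ)).subset ?_
    intro m hm
    simp only [Function.mem_support, crankCount, if_pos hn] at hm
    simp only [Set.mem_insert_iff, Set.mem_singleton_iff]
    by_contra h
    push Not at h
    simp [h.1, h.2.1, h.2.2] at hm
  · refine (Set.finite_range (fun p : n.Partition => crank p)).subset ?_
    intro m hm
    simp only [Function.mem_support, crankCount, if_neg hn, ne_eq, Nat.cast_eq_zero,
      Finset.card_eq_zero] at hm
    obtain ⟨p, hp⟩ := Finset.nonempty_iff_ne_empty.mpr hm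
    exact ⟨p, (Finset.mem_filter.mp hp).2⟩

/-- The `n`-th coefficient `∑_{m ∈ ℤ} m ^ k M(m, n)` of the `k`-th crank moment. -/
noncomputable def crankMomentCoeff (k n : ℕ) : ℤ :=
  ∑ᶠ m : ℤ, m ^ k * crankCount m n

/-- `C_k(q) = ∑_{n ≥ 0} (∑_{m ∈ ℤ} m ^ k M(m, n)) q ^ n`. -/
noncomputable def crankMoment (k : ℕ) (q : ℂ) : ℂ :=
  ∑' n : ℕ, (crankMomentCoeff k n : ℂ) * q ^ n

/-- `(q)_∞ = ∏_{n ≥ 1} (1 - q ^ n)`. -/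
noncomputable def eulerProduct (q : ℂ) : ℂ :=
  ∏' n : ℕ, (1 - q ^ (n + 1))

/-- The normalized crank moment `𝓒_k(q) = (q)_∞ C_k(q)`. -/
noncomputable def normalizedCrankMoment (k : ℕ) (q : ℂ) : ℂ :=
  eulerProduct q * crankMoment k q

/-- The variable `q = e ^ (2 π i τ)`. -/
noncomputable def nome (τ : UpperHalfPlane) : ℂ :=
  Complex.exp (2 * Real.pi * Complex.I * (τ : ℂ))

/-- The Eisenstein series of weight `2 k` (for `k ≥ 1`),
`G_{2k}(τ) = - B_{2k} / (4 k) + ∑_{n ≥ 1} σ_{2k-1}(n) q ^ n`. -/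
noncomputable def eisensteinG (k : ℕ) (τ : UpperHalfPlane) : ℂ :=
  -((bernoulli (2 * k) : ℚ) : ℂ) / (4 * (k : ℂ)) +
    ∑' n : ℕ, (ArithmeticFunction.sigma (2 * k - 1) (n + 1) : ℂ) * nome τ ^ (n + 1)

/-- The partition trace `Tr_k(φ; X_1, …, X_k) = ∑_{λ ⊢ k} φ(λ) ∏_{j=1}^k X_j ^ {m_j}`, where
`m_j` is the multiplicity of `j` in `λ` and `φ` is a function on the set of all partitions. -/
noncomputable def partitionTrace (k : ℕ) (φ : (n : ℕ) → n.Partition → ℂ) (X : ℕ → ℂ) : ℂ :=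
  ∑ p : k.Partition, φ k p * ∏ j ∈ Finset.Icc 1 k, X j ^ p.parts.count j

/-- `φ_M(λ) = (2k)! ∏_{j=1}^k 2 ^ {m_j} / (m_j! (2j)! ^ {m_j})` for `λ ⊢ k`. -/
noncomputable def phiM (k : ℕ) (p : k.Partition) : ℂ :=
  ((2 * k).factorial : ℂ) * ∏ j ∈ Finset.Icc 1 k,
    (2 : ℂ) ^ p.parts.count j / (((p.parts.count j).factorial : ℂ) * ((2 * j).factorial : ℂ) ^ p.parts.count j)

/-- `φ_S(λ) = ((2k)! / 2) (-1) ^ (ℓ(λ) - 1) (ℓ(λ) - 1)! ∏_{j=1}^k 1 / (m_j! (2j)! ^ {m_j})` for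
`λ ⊢ k` and `k ≥ 1`, where `ℓ(λ) ≥ 1` is the number of parts. -/
noncomputable def phiS (k : ℕ) (p : k.Partition) : ℂ :=
  ((2 * k).factorial : ℂ) / 2 * (-1) ^ (p.parts.card - 1) * ((p.parts.card - 1).factorial : ℂ) *
    ∏ j ∈ Finset.Icc 1 k,
      1 / (((p.parts.count j).factorial : ℂ) * ((2 * j).factorial : ℂ) ^ p.parts.count j)

end CrankTrace

/-! The crank generating function is the Andrews–Garvan product `∑ M(m,n) zᵐ qⁿ = (q)_∞ / ((zq)_∞
(z⁻¹q)_∞)`. Its logarithmic derivative `z d/dz` is `∑ₙ ∑_{m ∣ n} (zᵐ - z⁻ᵐ) qⁿ`. At `z = exp u` the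
coefficient of `uᵏ` on the left is the `k`-th crank moment divided by `k!`, while the divisor sums
vanish at even powers of `u` and give `2 σ_{2j-1}(n) / (2j-1)!` at `u^{2j-1}`. With `x = u²`, `y_n =
𝓒_{2n} / (2n)!`, `g_j = 2 Φ_j / (2j)!` and `Φ_j = ∑ σ_{2j-1}(n) qⁿ`, this says `x y' = (x g') y`
with `y_0 = 1`, that is, `y = exp g`. Expanding `exp g` and `g = log y` over partitions gives the
two traces (`eq_sum_expWeight`, `eq_sum_expWeight_log`).

The product formula is proved modulo `X ^ (N + 1)`, so that only finite products occur
(`X_pow_dvd_crankSeries_mul_sub`). Partitions are sorted by their number of ones or, without ones,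
by their largest part, and the resulting sums are evaluated by two cases of the `q`-binomial theorem
(`crank_product_of_nilpotent`). Convergence follows from Euler's product for the moment of order
zero and then from the moment recurrence itself (`summable_crankMomentCoeff`). -/

namespace CrankTrace

open Finset PowerSeries

/-! ### Generating series of functions on partitions -/

section PartitionSum

variable {R : Type*} [CommRing R]

/-- The power series `∑ₙ (∑_{λ ⊢ n} g(λ)) Xⁿ`. -/
noncomputable def partitionSum (g : Multiset ℕ → R) : R⟦X⟧ :=
  PowerSeries.mk fun n => ∑ p : n.Partition, g p.parts

theorem coeff_partitionSum (g : Multiset ℕ → R) (n : ℕ) :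
    coeff n (partitionSum g) = ∑ p : n.Partition, g p.parts := coeff_mk _ _

/-- Removing one copy of `a` is a bijection between the two index sets. -/
theorem sum_filter_mem_parts {n a : ℕ} (ha : 1 ≤ a) (han : a ≤ n) (g : Multiset ℕ → R) :
    ∑ p : n.Partition with a ∈ p.parts, g p.parts = ∑ p : (n - a).Partition, g (a ::ₘ p.parts) := by
  rw [← Finset.sum_subtype_eq_sum_filter, Finset.subtype_univ]
  refine Fintype.sum_equiv (Nat.Partition.partitionWithPartEquiv ha han) _ _ fun p => ?_
  rw [Nat.Partition.partitionWithPartEquiv_apply_parts, Multiset.cons_erase p.2]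

theorem partitionSum_ite_mem {a : ℕ} (ha : 1 ≤ a) (g : Multiset ℕ → R) :
    partitionSum (fun s => if a ∈ s then g s else 0) =
      X ^ a * partitionSum (fun s => g (a ::ₘ s)) := by
  ext n
  rw [coeff_partitionSum, ← Finset.sum_filter, coeff_X_pow_mul']
  split_ifs with h
  · rw [sum_filter_mem_parts ha h, coeff_partitionSum]
  · refine Finset.sum_eq_zero fun p hp => absurd ?_ h
    exact p.le_of_mem_parts (Finset.mem_filter.mp hp).2

theorem partitionSum_add (g h : Multiset ℕ → R) :
    partitionSum (fun s => g s + h s) = partitionSum g + partitionSum h := by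
  ext n
  simp [coeff_partitionSum, Finset.sum_add_distrib]

theorem partitionSum_const_mul (c : R) (g : Multiset ℕ → R) :
    partitionSum (fun s => c * g s) = C c * partitionSum g := by
  ext n
  simp [coeff_partitionSum, Finset.mul_sum]

theorem partition_zero_sum (g : Multiset ℕ → R) : ∑ p : (0 : ℕ).Partition, g p.parts = g 0 := by
  rw [Fintype.sum_unique]
  simp

end PartitionSum

/-! ### Exponential and logarithmic formulas over partitions -/

section Trace

variable {K : Type*} [Field K] [CharZero K]

/-- The weight `∏ⱼ c_j ^ {m_j} / m_j!` of a multiset with multiplicities `m_j`. -/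
noncomputable def expWeight (c : ℕ → K) (s : Multiset ℕ) : K :=
  ∏ j ∈ s.toFinset, c j ^ s.count j / ((s.count j).factorial : K)

theorem expWeight_eq_prod (c : ℕ → K) {s : Multiset ℕ} {t : Finset ℕ} (h : s.toFinset ⊆ t) :
    expWeight c s = ∏ j ∈ t, c j ^ s.count j / ((s.count j).factorial : K) := by
  refine Finset.prod_subset h fun j _ hj => ?_
  rw [Multiset.mem_toFinset] at hj
  simp [Multiset.count_eq_zero_of_notMem hj]

/-- The multiplicity cancels one factor of its factorial, as in the derivative of the exponential
series. -/
theorem count_mul_expWeight_cons (c : ℕ → K) (a : ℕ) (s : Multiset ℕ) :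
    ((a ::ₘ s).count a : K) * expWeight c (a ::ₘ s) = c a * expWeight c s := by
  have h1 : s.toFinset ⊆ insert a s.toFinset := Finset.subset_insert _ _
  rw [expWeight_eq_prod c h1, expWeight, Multiset.toFinset_cons,
    ← Finset.mul_prod_erase _ _ (Finset.mem_insert_self a s.toFinset),
    ← Finset.mul_prod_erase (insert a s.toFinset) (fun j => c j ^ s.count j / _)
      (Finset.mem_insert_self a s.toFinset), ← mul_assoc, ← mul_assoc]
  congr 1
  · rw [Multiset.count_cons_self, Nat.factorial_succ, pow_succ]
    have : ((s.count a).factorial : K) ≠ 0 := by exact_mod_cast (s.count a).factorial_ne_zero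
    have h2 : ((s.count a + 1 : ℕ) : K) ≠ 0 := by exact_mod_cast (s.count a).succ_ne_zero
    push_cast at h2 ⊢
    field_simp
  · refine Finset.prod_congr rfl fun j hj => ?_
    rw [Multiset.count_cons_of_ne (Finset.ne_of_mem_erase hj)]

theorem sum_count_mul_expWeight {c : ℕ → K} (hc : c 0 = 0) (f : ℕ → K) {n a : ℕ} (han : a ≤ n) :
    ∑ p : n.Partition, (p.parts.count a : K) * (expWeight c p.parts * f p.parts.card) =
      c a * ∑ p : (n - a).Partition, expWeight c p.parts * f (p.parts.card + 1) := by
  rcases Nat.eq_zero_or_pos a with rfl | ha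
  · rw [hc, zero_mul]
    refine Finset.sum_eq_zero fun p _ => ?_
    rw [Multiset.count_eq_zero_of_notMem fun h => (p.parts_pos h).ne' rfl]
    simp
  · rw [← Finset.sum_filter_of_ne (p := fun p : n.Partition => a ∈ p.parts),
      sum_filter_mem_parts ha han
        (fun s => (s.count a : K) * (expWeight c s * f s.card)), Finset.mul_sum]
    · refine Finset.sum_congr rfl fun p _ => ?_
      rw [← mul_assoc, count_mul_expWeight_cons, Multiset.card_cons, mul_assoc]
    · intro p _ hp
      by_contra h
      simp [Multiset.count_eq_zero_of_notMem h] at hp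

/-- Marking one part and removing it splits off the factor `h a * c a` and lowers the length by one.
Two choices of `h` matter: the identity, which gives the operator `x d/dx`, and the constant `1`,
which gives the length. -/
theorem partitionSum_map_sum_mul_expWeight {c : ℕ → K} (hc : c 0 = 0) (h f : ℕ → K) :
    partitionSum (fun s => (s.map h).sum * (expWeight c s * f s.card)) =
      PowerSeries.mk (fun j => h j * c j) *
        partitionSum (fun s => expWeight c s * f (s.card + 1)) := by
  ext n
  rw [coeff_mul, coeff_partitionSum, Finset.Nat.sum_antidiagonal_eq_sum_range_succ_mk]
  simp only [coeff_mk, coeff_partitionSum]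
  have key : ∀ a ∈ Finset.range (n + 1),
      h a * c a * ∑ p : (n - a).Partition, expWeight c p.parts * f (p.parts.card + 1) =
      ∑ p : n.Partition, (p.parts.count a : K) * h a * (expWeight c p.parts * f p.parts.card) := by
    intro a ha
    rw [mul_assoc, ← sum_count_mul_expWeight hc f (Finset.mem_range_succ_iff.mp ha),
      Finset.mul_sum]
    exact Finset.sum_congr rfl fun p _ => by ring
  rw [Finset.sum_congr rfl key, Finset.sum_comm]
  refine Finset.sum_congr rfl fun p _ => ?_
  rw [← Finset.sum_mul, Finset.sum_multiset_map_count]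
  congr 1
  simp only [nsmul_eq_mul]
  refine Finset.sum_subset (fun j hj => ?_) fun j _ hj => ?_
  · rw [Multiset.mem_toFinset] at hj
    exact Finset.mem_range_succ_iff.mpr (p.le_of_mem_parts hj)
  · rw [Multiset.mem_toFinset] at hj
    simp [Multiset.count_eq_zero_of_notMem hj]

theorem partitionSum_sum_mul_expWeight {c : ℕ → K} (hc : c 0 = 0) (f : ℕ → K) :
    PowerSeries.mk (fun n => (n : K) * ∑ p : n.Partition, expWeight c p.parts * f p.parts.card) =
      PowerSeries.mk (fun j => (j : K) * c j) *
        partitionSum (fun s => expWeight c s * f (s.card + 1)) := by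
  rw [← partitionSum_map_sum_mul_expWeight hc]
  ext n
  rw [coeff_mk, coeff_partitionSum, Finset.mul_sum]
  refine Finset.sum_congr rfl fun p _ => ?_
  congr 1
  rw [← Multiset.map_id p.parts, ← Multiset.map_id p.parts]
  conv_lhs => rw [← p.parts_sum]
  simp [Nat.cast_multiset_sum]

/-- The exponential formula: the partition sums of `expWeight` solve `x dy = x y dg`. -/
theorem eq_sum_expWeight {g y : ℕ → K} (hg : g 0 = 0) (hy : y 0 = 1)
    (h : PowerSeries.mk (fun n => (n : K) * y n) =
      PowerSeries.mk (fun j => (j : K) * g j) * PowerSeries.mk y) (n : ℕ) :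
    y n = ∑ p : n.Partition, expWeight g p.parts := by
  have h2 := partitionSum_sum_mul_expWeight hg (fun _ => (1 : K))
  simp only [mul_one] at h2
  induction n using Nat.strong_induction_on with
  | _ n ih =>
    rcases Nat.eq_zero_or_pos n with rfl | hn
    · rw [partition_zero_sum, hy]
      simp [expWeight]
    · have hn' : (n : K) ≠ 0 := by exact_mod_cast hn.ne'
      apply mul_left_cancel₀ hn'
      have e1 := congrArg (coeff n) h
      have e2 := congrArg (coeff n) h2
      rw [coeff_mk, coeff_mul] at e1 e2
      rw [e1, e2]
      refine Finset.sum_congr rfl fun x hx => ?_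
      rw [Finset.HasAntidiagonal.mem_antidiagonal] at hx
      -- Only the term with `x.1 = 0` contains `y n` itself, and its factor `0` kills it, so the
      -- equation determines `y n` from smaller indices.
      rcases Nat.eq_zero_or_pos x.1 with h0 | h0
      · simp [h0]
      · rw [coeff_mk (n := x.2), coeff_partitionSum, ih x.2 (by omega)]

/-- The logarithmic formula, inverting `eq_sum_expWeight`. -/
theorem eq_sum_expWeight_log {g y : ℕ → K} (hy : y 0 = 1)
    (h : PowerSeries.mk (fun n => (n : K) * y n) =
      PowerSeries.mk (fun j => (j : K) * g j) * PowerSeries.mk y) {n : ℕ} (hn : 1 ≤ n) :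
    g n = ∑ p : n.Partition, expWeight y p.parts *
      ((-1) ^ (p.parts.card - 1) * ((p.parts.card - 1).factorial : K)) := by
  -- `c` is `y` without its constant term; partitions have no part `0`, so the weights agree.
  set c : ℕ → K := fun j => if j = 0 then 0 else y j with hcdef
  have hc : c 0 = 0 := if_pos rfl
  have hcy : ∀ (m : ℕ) (p : m.Partition), expWeight y p.parts = expWeight c p.parts := by
    intro m p
    refine Finset.prod_congr rfl fun j hj => ?_
    rw [Multiset.mem_toFinset] at hj
    simp [hcdef, (p.parts_pos hj).ne']
  -- By the multinomial theorem `U` is `∑ (-c)^l = 1 / (1 + c) = 1 / y`. Below, `hT` is `x d/dx log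
  -- y = x c' U`, and `hV`, which weights by the length, yields `U = 1 - c U`. The truncated `l - 1`
  -- at `l = 0` is harmless: it meets a factor `n = 0` or length `0`.
  set U : K⟦X⟧ := partitionSum (fun s => expWeight c s * ((-1) ^ s.card * (s.card.factorial : K)))
    with hU
  have hT := partitionSum_sum_mul_expWeight hc
    (fun l => (-1) ^ (l - 1) * ((l - 1).factorial : K))
  have hV := partitionSum_map_sum_mul_expWeight hc (fun _ => 1)
    (fun l => (-1) ^ (l - 1) * ((l - 1).factorial : K))
  simp only [Nat.add_sub_cancel, one_mul] at hT hV
  rw [← hU] at hT hV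
  have hUy : U * PowerSeries.mk y = 1 := by
    have e1 : PowerSeries.mk y = 1 + PowerSeries.mk c := by
      ext m
      rcases Nat.eq_zero_or_pos m with rfl | hm
      · simp [hy, hc]
      · simp [coeff_one, hm.ne', hcdef]
    have e2 : U = 1 - PowerSeries.mk c * U := by
      rw [← hV]
      ext m
      rw [map_sub, hU, coeff_partitionSum, coeff_partitionSum]
      rcases Nat.eq_zero_or_pos m with rfl | hm
      · rw [partition_zero_sum (fun s => expWeight c s * ((-1) ^ s.card * (s.card.factorial : K))),
          partition_zero_sum (fun s => (s.map fun _ => (1 : K)).sum * (expWeight c s *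
            ((-1) ^ (s.card - 1) * ((s.card - 1).factorial : K))))]
        simp [expWeight]
      · rw [coeff_one, if_neg hm.ne', zero_sub, ← Finset.sum_neg_distrib]
        refine Finset.sum_congr rfl fun p _ => ?_
        have hp : p.parts.card ≠ 0 := by
          intro h0
          have := p.parts_sum
          rw [Multiset.card_eq_zero.mp h0] at this
          simp at this
          omega
        obtain ⟨l, hl⟩ := Nat.exists_eq_succ_of_ne_zero hp
        simp only [hl, Multiset.map_const', Multiset.sum_replicate, Nat.succ_eq_add_one,
          Nat.add_sub_cancel, Nat.factorial_succ, nsmul_eq_mul]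
        push_cast
        ring
    rw [e1]
    linear_combination e2
  have hcy' : PowerSeries.mk (fun j => (j : K) * c j) = PowerSeries.mk (fun j => (j : K) * y j) := by
    ext m
    rcases Nat.eq_zero_or_pos m with rfl | hm
    · simp
    · simp [hcdef, hm.ne']
  rw [hcy', h, mul_assoc, mul_comm (PowerSeries.mk y), hUy, mul_one] at hT
  have e := congrArg (coeff n) hT
  rw [coeff_mk, coeff_mk] at e
  have hn' : (n : K) ≠ 0 := by exact_mod_cast (by omega : n ≠ 0)
  rw [← mul_left_cancel₀ hn' e]
  exact Finset.sum_congr rfl fun p _ => by rw [hcy]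

end Trace

/-! ### The two traces as weighted partition sums -/

theorem toFinset_parts_subset {k : ℕ} (p : k.Partition) : p.parts.toFinset ⊆ Finset.Icc 1 k := by
  intro j hj
  rw [Multiset.mem_toFinset] at hj
  exact Finset.mem_Icc.mpr ⟨p.parts_pos hj, p.le_of_mem_parts hj⟩

theorem partitionTrace_phiM (k : ℕ) (x : ℕ → ℂ) :
    partitionTrace k phiM x = ((2 * k).factorial : ℂ) *
      ∑ p : k.Partition, expWeight (fun j => 2 * x j / ((2 * j).factorial : ℂ)) p.parts := by
  rw [partitionTrace, Finset.mul_sum]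
  refine Finset.sum_congr rfl fun p _ => ?_
  rw [expWeight_eq_prod _ (toFinset_parts_subset p), phiM, mul_assoc, ← Finset.prod_mul_distrib]
  congr 1
  refine Finset.prod_congr rfl fun j _ => ?_
  rw [div_pow, mul_pow, div_mul_eq_mul_div, div_div, mul_comm (Nat.cast (Nat.factorial _))]

theorem partitionTrace_phiS (k : ℕ) (x : ℕ → ℂ) :
    partitionTrace k phiS x = ((2 * k).factorial : ℂ) / 2 *
      ∑ p : k.Partition, expWeight (fun j => x j / ((2 * j).factorial : ℂ)) p.parts *
        ((-1) ^ (p.parts.card - 1) * ((p.parts.card - 1).factorial : ℂ)) := by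
  rw [partitionTrace, Finset.mul_sum]
  refine Finset.sum_congr rfl fun p _ => ?_
  rw [expWeight_eq_prod _ (toFinset_parts_subset p), phiS, mul_assoc, ← Finset.prod_mul_distrib]
  have : ∏ j ∈ Finset.Icc 1 k, 1 / (((p.parts.count j).factorial : ℂ) *
      ((2 * j).factorial : ℂ) ^ p.parts.count j) * x j ^ p.parts.count j =
      ∏ j ∈ Finset.Icc 1 k, (x j / ((2 * j).factorial : ℂ)) ^ p.parts.count j /
        ((p.parts.count j).factorial : ℂ) := by
    refine Finset.prod_congr rfl fun j _ => ?_
    rw [div_pow, div_mul_eq_mul_div, one_mul, div_div,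
      mul_comm (Nat.cast (Nat.factorial (Multiset.count _ _)))]
  rw [this]
  ring

/-! ### The `q`-binomial theorem for nilpotent `q` -/

section QBinomial

variable {B : Type*} [CommRing B]

/-- The recurrence for `c` is the functional equation `(1 - t) F(t) = (1 - a t) F(t q)` of `F(t) = ∑
c_n tⁿ`; nilpotency of `t` removes the boundary term of the truncated sum. -/
theorem qBinomial_step {q t a : B} {N : ℕ} {c : ℕ → B}
    (hc : ∀ n, (1 - q ^ (n + 1)) * c (n + 1) = (1 - a * q ^ n) * c n) (ht : t ^ (N + 1) = 0) :
    (1 - t) * ∑ n ∈ range (N + 1), c n * t ^ n =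
      (1 - a * t) * ∑ n ∈ range (N + 1), c n * (t * q) ^ n := by
  have h1 : ∑ n ∈ range (N + 1), c n * t ^ n - ∑ n ∈ range (N + 1), c n * (t * q) ^ n =
      t * ∑ n ∈ range (N + 1), (1 - a * q ^ n) * c n * t ^ n := by
    rw [← Finset.sum_sub_distrib, Finset.sum_range_succ', Finset.sum_range_succ _ N, mul_add]
    have : t * ((1 - a * q ^ N) * c N * t ^ N) = 0 := by
      linear_combination (1 - a * q ^ N) * c N * ht
    rw [this, Finset.mul_sum]
    simp only [pow_zero, mul_one, sub_self]
    congr 1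
    refine Finset.sum_congr rfl fun n _ => ?_
    rw [← hc n]
    ring
  have h2 : ∑ n ∈ range (N + 1), (1 - a * q ^ n) * c n * t ^ n =
      ∑ n ∈ range (N + 1), c n * t ^ n - a * ∑ n ∈ range (N + 1), c n * (t * q) ^ n := by
    rw [Finset.mul_sum, ← Finset.sum_sub_distrib]
    exact Finset.sum_congr rfl fun n _ => by ring
  rw [h2] at h1
  linear_combination h1

/-- The `q`-binomial theorem for nilpotent `q`. -/
theorem qBinomial_of_pow_eq_zero {q d a : B} {N : ℕ} (hq : q ^ (N + 1) = 0) {c : ℕ → B}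
    (h0 : c 0 = 1) (hc : ∀ n, (1 - q ^ (n + 1)) * c (n + 1) = (1 - a * q ^ n) * c n) :
    (∏ i ∈ range N, (1 - d * q ^ (i + 1))) * ∑ n ∈ range (N + 1), c n * (d * q) ^ n =
      ∏ i ∈ range N, (1 - a * (d * q ^ (i + 1))) := by
  -- The functional equation iterated `k` times. At `k = N` the argument `d * q ^ (N + 1)` is zero
  -- and only `c 0 = 1` remains.
  have key : ∀ k, (∏ i ∈ range k, (1 - d * q ^ (i + 1))) * ∑ n ∈ range (N + 1), c n * (d * q) ^ n =
      (∏ i ∈ range k, (1 - a * (d * q ^ (i + 1)))) *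
        ∑ n ∈ range (N + 1), c n * (d * q ^ (k + 1)) ^ n := by
    intro k
    induction k with
    | zero => simp
    | succ k ih =>
      have ht : (d * q ^ (k + 1)) ^ (N + 1) = 0 := by
        rw [mul_pow, ← pow_mul, mul_comm (k + 1), pow_mul, hq, zero_pow k.succ_ne_zero, mul_zero]
      have := qBinomial_step hc ht
      rw [mul_assoc, ← pow_succ] at this
      rw [Finset.prod_range_succ, Finset.prod_range_succ, mul_right_comm, ih, mul_right_comm,
        mul_assoc, this]
      ring
  rw [key N, hq, Finset.sum_range_succ']
  simp [h0]

end QBinomial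

/-! ### Decomposition of the crank generating function -/

section CrankSeries

variable {R : Type*} [CommRing R]

/-- The sum of `∏ x_i X ^ i` over all partitions having no part in `S`. -/
noncomputable def avoidingSum (S : Finset ℕ) (x : ℕ → R) : R⟦X⟧ :=
  partitionSum fun s => if ∀ j ∈ S, j ∉ s then (s.map x).prod else 0

/-- As `a ∉ S`, the partitions avoiding `S` and containing `a` arise by adding one `a` to any
partition avoiding `S`; subtracting them leaves those avoiding `a` as well. -/
theorem one_sub_mul_avoidingSum {S : Finset ℕ} {a : ℕ} (ha : 1 ≤ a) (haS : a ∉ S) (x : ℕ → R) :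
    (1 - C (x a) * X ^ a) * avoidingSum S x = avoidingSum (insert a S) x := by
  have h1 : avoidingSum S x = avoidingSum (insert a S) x +
      partitionSum (fun s => if a ∈ s then
        (if ∀ j ∈ S, j ∉ s then (s.map x).prod else 0) else 0) := by
    rw [avoidingSum, avoidingSum, ← partitionSum_add]
    congr 1
    funext s
    by_cases h : a ∈ s <;> simp [h]
  have h2 : (fun s : Multiset ℕ => if ∀ j ∈ S, j ∉ a ::ₘ s then ((a ::ₘ s).map x).prod else 0) =
      fun s => x a * (if ∀ j ∈ S, j ∉ s then (s.map x).prod else 0) := by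
    funext s
    have : (∀ j ∈ S, j ∉ a ::ₘ s) ↔ ∀ j ∈ S, j ∉ s := by
      refine forall₂_congr fun j hj => ?_
      rw [Multiset.mem_cons, not_or, and_iff_right]
      rintro rfl
      exact haS hj
    simp only [this, mul_ite, mul_zero, Multiset.map_cons, Multiset.prod_cons]
  rw [partitionSum_ite_mem ha, h2, partitionSum_const_mul] at h1
  change avoidingSum S x = _ + X ^ a * (C (x a) * avoidingSum S x) at h1
  linear_combination h1

theorem prod_mul_avoidingSum {S T : Finset ℕ} (hT : ∀ a ∈ T, 1 ≤ a) (hST : Disjoint T S)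
    (x : ℕ → R) :
    (∏ a ∈ T, (1 - C (x a) * X ^ a)) * avoidingSum S x = avoidingSum (T ∪ S) x := by
  induction T using Finset.induction_on with
  | empty => simp
  | insert a T haT ih =>
    rw [Finset.disjoint_insert_left] at hST
    rw [Finset.prod_insert haT, mul_assoc,
      ih (fun b hb => hT b (Finset.mem_insert_of_mem hb)) hST.2,
      one_sub_mul_avoidingSum (hT a (Finset.mem_insert_self a T)), Finset.insert_union]
    simp [haT, hST.1]

/-- Every part of a partition of `n ≤ N` lies in `Icc 1 N`, so only the empty partition survives.
With `prod_mul_avoidingSum` this replaces the infinite Euler product. -/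
theorem coeff_avoidingSum_Icc (x : ℕ → R) {n N : ℕ} (h : n ≤ N) :
    coeff n (avoidingSum (Icc 1 N) x) = if n = 0 then 1 else 0 := by
  rw [avoidingSum, coeff_partitionSum]
  split_ifs with h0
  · subst h0
    rw [Fintype.sum_unique]
    simp
  · refine Finset.sum_eq_zero fun p _ => if_neg fun hp => ?_
    obtain ⟨a, ha⟩ : ∃ a, a ∈ p.parts := by
      refine Multiset.exists_mem_of_ne_zero fun hz => h0 ?_
      rw [← p.parts_sum, hz, Multiset.sum_zero]
    exact hp a (Finset.mem_Icc.mpr ⟨p.parts_pos ha, (p.le_of_mem_parts ha).trans h⟩) ha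

theorem partitionSum_count_one_eq (g : Multiset ℕ → R) (hg : ∀ s, g (1 ::ₘ s) = g s) (c : ℕ) :
    partitionSum (fun s => if s.count 1 = c then g s else 0) =
      X ^ c * partitionSum (fun s => if s.count 1 = 0 then g s else 0) := by
  induction c with
  | zero => simp
  | succ c ih =>
    have h1 : (fun s : Multiset ℕ => if s.count 1 = c + 1 then g s else 0) =
        fun s => if 1 ∈ s then (if s.count 1 = c + 1 then g s else 0) else 0 := by
      funext s
      by_cases h : 1 ∈ s
      · rw [if_pos h]
      · rw [if_neg h, Multiset.count_eq_zero_of_notMem h, if_neg (by omega)]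
    rw [h1, partitionSum_ite_mem le_rfl]
    simp only [Multiset.count_cons_self, hg, Nat.add_right_cancel_iff]
    rw [ih, pow_succ]
    ring

/-- Since `J ≥ 1`, ones never count as parts larger than `J`. They can be stripped off, and each
remaining part contributes `z` exactly when it exceeds `J`. -/
theorem partitionSum_ones (w z : R) {J : ℕ} (hJ : 1 ≤ J) :
    partitionSum (fun s => if s.count 1 = J then w ^ J * z ^ s.countP (J < ·) else 0) =
      C (w ^ J) * X ^ J * avoidingSum {1} (fun i => if i ≤ J then 1 else z) := by
  rw [partitionSum_count_one_eq (fun s => w ^ J * z ^ s.countP (J < ·))]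
  · rw [mul_comm (C _), mul_assoc, avoidingSum, ← partitionSum_const_mul]
    congr 2
    funext s
    have hz : (s.map fun i => if i ≤ J then 1 else z).prod = z ^ s.countP (J < ·) := by
      induction s using Multiset.induction_on with
      | empty => simp
      | cons a s ih =>
        rw [Multiset.map_cons, Multiset.prod_cons, ih, Multiset.countP_cons]
        by_cases h : a ≤ J
        · simp [h, not_lt.mpr h]
        · simp [h, not_le.mp h, pow_succ, mul_comm]
    simp [hz, Multiset.count_eq_zero]
  · intro s
    simp [not_lt.mpr hJ]

theorem sup_eq_iff_mem {s : Multiset ℕ} {m : ℕ} (hm : 1 ≤ m) :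
    s.sup = m ↔ m ∈ s ∧ ∀ i ∈ s, i ≤ m := by
  constructor
  · rintro rfl
    refine ⟨?_, fun i hi => Multiset.le_sup hi⟩
    induction s using Multiset.induction_on with
    | empty => simp at hm
    | cons a s ih =>
      rw [Multiset.sup_cons] at hm ⊢
      rcases le_total a s.sup with h | h
      · rw [sup_eq_right.mpr h] at hm ⊢
        exact Multiset.mem_cons_of_mem (ih hm)
      · rw [sup_eq_left.mpr h]
        exact Multiset.mem_cons_self a s
  · rintro ⟨h1, h2⟩
    exact le_antisymm (Multiset.sup_le.mpr h2) (Multiset.le_sup h1)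

/-- One copy of the largest part `m` is removed; weight `0` on parts above `m` enforces that `m` is
largest. -/
theorem partitionSum_largest (z : R) {m : ℕ} (hm : 2 ≤ m) :
    partitionSum (fun s => if s.count 1 = 0 ∧ s.sup = m then z ^ m else 0) =
      C (z ^ m) * X ^ m * avoidingSum {1} (fun i => if i ≤ m then 1 else 0) := by
  have h1 : (fun s : Multiset ℕ => if s.count 1 = 0 ∧ s.sup = m then z ^ m else 0) =
      fun s => if m ∈ s then (if 1 ∉ s ∧ ∀ i ∈ s, i ≤ m then z ^ m else 0) else 0 := by
    funext s
    simp only [sup_eq_iff_mem (show 1 ≤ m by omega), Multiset.count_eq_zero]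
    by_cases h : m ∈ s <;> simp [h]
  rw [h1, partitionSum_ite_mem (by omega), mul_comm (C _), mul_assoc, avoidingSum,
    ← partitionSum_const_mul]
  congr 2
  funext s
  have hz : (s.map fun i => if i ≤ m then (1 : R) else 0).prod =
      if ∀ i ∈ s, i ≤ m then 1 else 0 := by
    induction s using Multiset.induction_on with
    | empty => simp
    | cons a s ih =>
      rw [Multiset.map_cons, Multiset.prod_cons, ih]
      by_cases h : a ≤ m <;> simp [h]
  have h3 : (1 ∉ m ::ₘ s ∧ ∀ i ∈ m ::ₘ s, i ≤ m) ↔ (1 ∉ s ∧ ∀ i ∈ s, i ≤ m) := by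
    simp only [Multiset.mem_cons, not_or, forall_eq_or_imp, le_refl, true_and]
    exact and_congr_left fun _ => and_iff_right (by omega)
  rw [hz]
  simp only [h3, Finset.mem_singleton, forall_eq]
  by_cases h4 : 1 ∈ s <;> by_cases h5 : ∀ i ∈ s, i ≤ m <;> simp [h4, h5]

/-- The generating function `∑ₙ (∑ₘ M(m, n) z ^ m) X ^ n` of the crank. -/
noncomputable def crankSeries (z : Rˣ) : R⟦X⟧ :=
  PowerSeries.mk fun n =>
    if n = 1 then (z : R) + ((z⁻¹ : Rˣ) : R) - 1
    else ∑ p : n.Partition, ((z ^ crank p : Rˣ) : R)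

/-- Exactly one of the three terms is active: empty partition, no ones (largest part then at least
`2`), or `J ≥ 1` ones. -/
theorem zpow_crank_eq (z : Rˣ) {n N : ℕ} (hn : n ≠ 1) (hnN : n ≤ N) (p : n.Partition) :
    ((z ^ crank p : Rˣ) : R) = (if n = 0 then 1 else 0) +
      ∑ m ∈ Icc 2 N, (if p.parts.count 1 = 0 ∧ p.parts.sup = m then (z : R) ^ m else 0) +
      ∑ J ∈ Icc 1 N, (if p.parts.count 1 = J then
        ((z⁻¹ : Rˣ) : R) ^ J * (z : R) ^ p.parts.countP (J < ·) else 0) := by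
  by_cases h : p.parts.count 1 = 0
  · have h3 : ∑ J ∈ Icc 1 N, (if p.parts.count 1 = J then
        ((z⁻¹ : Rˣ) : R) ^ J * (z : R) ^ p.parts.countP (J < ·) else 0) = 0 := by
      refine Finset.sum_eq_zero fun J hJ => if_neg ?_
      have := (Finset.mem_Icc.mp hJ).1
      omega
    rw [h3, add_zero, crank, if_pos h]
    simp only [h, true_and, zpow_natCast, Units.val_pow_eq_pow_val]
    rw [Finset.sum_ite_eq]
    rcases Nat.eq_zero_or_pos n with rfl | hpos
    · simp
    · have hpz : p.parts ≠ 0 := fun h0 => by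
        have := p.parts_sum
        rw [h0, Multiset.sum_zero] at this
        omega
      obtain ⟨a, ha⟩ := Multiset.exists_mem_of_ne_zero hpz
      have ha2 : 2 ≤ a := by
        have := p.parts_pos ha
        have : a ≠ 1 := fun h1 => Multiset.count_eq_zero.mp h (h1 ▸ ha)
        omega
      have hs : p.parts.sup ∈ Icc 2 N := by
        refine Finset.mem_Icc.mpr ⟨ha2.trans (Multiset.le_sup ha), Multiset.sup_le.mpr ?_⟩
        exact fun b hb => (p.le_of_mem_parts hb).trans hnN
      rw [if_pos hs, if_neg hpos.ne', zero_add]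
  · have h0 : n ≠ 0 := by
      rintro rfl
      simp at h
    have h2 : ∑ m ∈ Icc 2 N,
        (if p.parts.count 1 = 0 ∧ p.parts.sup = m then (z : R) ^ m else 0) = 0 :=
      Finset.sum_eq_zero fun m _ => if_neg fun hh => h hh.1
    have hmem : p.parts.count 1 ∈ Icc 1 N := by
      refine Finset.mem_Icc.mpr ⟨Nat.pos_of_ne_zero h, le_trans ?_ hnN⟩
      conv_rhs => rw [← p.parts_sum]
      refine (Multiset.count_le_card _ _).trans ?_
      simpa using Multiset.card_nsmul_le_sum (s := p.parts) (a := 1) fun x hx => p.parts_pos hx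
    rw [h2, if_neg h0, zero_add, zero_add, Finset.sum_ite_eq, if_pos hmem, crank, if_neg h,
      zpow_sub, zpow_natCast, zpow_natCast, Units.val_mul, ← inv_pow, mul_comm]
    simp

/-- The term `(z - 1) X` accounts for the convention at `n = 1`: the only partition of `1` has crank
`-1` and contributes `z⁻¹`, whereas the convention asks for `z + z⁻¹ - 1`. -/
theorem X_pow_dvd_crankSeries_sub (z : Rˣ) (N : ℕ) (hN : 1 ≤ N) :
    (X : R⟦X⟧) ^ (N + 1) ∣ crankSeries z - (1 + (C (z : R) - 1) * X +
      ∑ m ∈ Icc 2 N, partitionSum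
        (fun s => if s.count 1 = 0 ∧ s.sup = m then (z : R) ^ m else 0) +
      ∑ J ∈ Icc 1 N, partitionSum (fun s => if s.count 1 = J then
        ((z⁻¹ : Rˣ) : R) ^ J * (z : R) ^ s.countP (J < ·) else 0)) := by
  rw [X_pow_dvd_iff]
  intro n hn
  rw [map_sub, sub_eq_zero, crankSeries, coeff_mk, map_add, map_add, map_add, map_sum, map_sum]
  simp only [coeff_partitionSum]
  rw [sub_mul, one_mul, map_sub, coeff_C_mul, coeff_one, coeff_X]
  split_ifs with h1 h0 h0
  · omega
  · subst h1
    simp only [Fintype.sum_unique]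
    have e1 : ∑ m ∈ Icc 2 N, (if (default : (1 : ℕ).Partition).parts.count 1 = 0 ∧
        (default : (1 : ℕ).Partition).parts.sup = m then (z : R) ^ m else 0) = 0 :=
      Finset.sum_eq_zero fun m _ => if_neg fun hh => by simp at hh
    rw [e1]
    simp only [Nat.Partition.partition_one_parts, Multiset.count_singleton_self]
    rw [Finset.sum_ite_eq, if_pos (Finset.mem_Icc.mpr ⟨le_rfl, hN⟩)]
    simp only [← Multiset.cons_zero, Multiset.countP_cons, Multiset.countP_zero]
    simp
    ring
  all_goals
    rw [Finset.sum_congr rfl fun p _ => zpow_crank_eq z h1 (Nat.lt_succ_iff.mp hn) p,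
      Finset.sum_add_distrib, Finset.sum_add_distrib, Finset.sum_comm,
      Finset.sum_comm (s := univ) (t := Icc 1 N)]
    simp [h0]

end CrankSeries

/-! ### The Andrews–Garvan product -/

section Product

/-- After multiplication by `P`, the no-ones terms sum to `1 - q` by the `q`-binomial theorem with
`a = 0`. This is the missing `J = 0` term of the sum over `J`, which the case `a = z q` then
evaluates. -/
theorem crank_product_of_nilpotent {B : Type*} [CommRing B] {q z w : B} {N : ℕ}
    (hq : q ^ (N + 1) = 0) (hzw : z * w = 1) (hN : 1 ≤ N) {a b : ℕ → B}
    (ha : ∀ J ∈ Icc 1 N, (∏ i ∈ range J, (1 - q ^ (i + 1))) *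
      (∏ i ∈ Ico J N, (1 - z * q ^ (i + 1))) * a J = 1 - q)
    (hb : ∀ m ∈ Icc 1 N, (∏ i ∈ range m, (1 - q ^ (i + 1))) * b m = 1 - q) :
    (1 + (z - 1) * q + ∑ m ∈ Icc 2 N, z ^ m * q ^ m * b m +
      ∑ J ∈ Icc 1 N, w ^ J * q ^ J * a J) *
      ((∏ i ∈ range N, (1 - z * q ^ (i + 1))) * ∏ i ∈ range N, (1 - w * q ^ (i + 1))) =
      ∏ i ∈ range N, (1 - q ^ (i + 1)) := by
  have hunit : ∀ n, IsUnit (∏ i ∈ range n, (1 - q ^ (i + 1))) := fun n => by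
    refine IsUnit.prod_iff.mpr fun i _ => ?_
    exact (IsNilpotent.pow_of_pos ⟨N + 1, hq⟩ i.succ_ne_zero).isUnit_one_sub
  -- `e n` is the inverse of `(1 - q) ⋯ (1 - q ^ n)`.
  choose e he using fun n => (hunit n).exists_right_inv
  have he0 : e 0 = 1 := by simpa using he 0
  have hes : ∀ n, (1 - q ^ (n + 1)) * e (n + 1) = e n := fun n => by
    have h1 := he (n + 1)
    rw [Finset.prod_range_succ] at h1
    linear_combination e n * h1 - ((1 - q ^ (n + 1)) * e (n + 1)) * he n
  set P := ∏ i ∈ range N, (1 - z * q ^ (i + 1)) with hP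
  set W := ∏ i ∈ range N, (1 - w * q ^ (i + 1)) with hW
  have hb' : ∀ m ∈ Icc 1 N, b m = (1 - q) * e m := fun m hm => by
    linear_combination e m * hb m hm - b m * he m
  have ha' : ∀ J ∈ Icc 1 N, a J * P = (1 - q) * e J * ∏ i ∈ range J, (1 - z * q ^ (i + 1)) := by
    intro J hJ
    rw [hP, ← Finset.prod_range_mul_prod_Ico _ (Finset.mem_Icc.mp hJ).2]
    linear_combination (e J * ∏ i ∈ range J, (1 - z * q ^ (i + 1))) * ha J hJ -
      (a J * (∏ i ∈ range J, (1 - z * q ^ (i + 1))) * (∏ i ∈ Ico J N, (1 - z * q ^ (i + 1)))) * he J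
  have hsum : ∀ f : ℕ → B, ∑ n ∈ range (N + 1), f n = f 0 + ∑ n ∈ Icc 1 N, f n := by
    intro f
    rw [Finset.range_eq_Ico, Finset.sum_eq_sum_Ico_succ_bot (Nat.succ_pos N)]
    rfl
  have hI := qBinomial_of_pow_eq_zero (d := z) (a := 0) hq he0 (fun n => by simpa using hes n)
  have hII := qBinomial_of_pow_eq_zero (d := w) (a := z * q) hq
    (c := fun j => e j * ∏ i ∈ range j, (1 - z * q ^ (i + 1))) (by simp [he0]) (fun n => by
      rw [Finset.prod_range_succ, ← hes n]
      ring)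
  -- As `z w = 1`, the factors are `1 - q ^ (i + 2)`; `1 - q` restores the first one, and the last
  -- equals `1` because `q ^ (N + 1) = 0`.
  have hr : (∏ i ∈ range N, (1 - z * q * (w * q ^ (i + 1)))) * (1 - q) =
      ∏ i ∈ range N, (1 - q ^ (i + 1)) := by
    have h1 : ∀ i, 1 - z * q * (w * q ^ (i + 1)) = 1 - q ^ (i + 1 + 1) := fun i => by
      linear_combination (-q * q ^ (i + 1)) * hzw
    have h2 : ∏ i ∈ range (N + 1), (1 - q ^ (i + 1)) = ∏ i ∈ range N, (1 - q ^ (i + 1)) := by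
      rw [Finset.prod_range_succ, hq, sub_zero, mul_one]
    rw [← h2, Finset.prod_range_succ']
    simp [h1]
  rw [← hP, hsum] at hI
  rw [← hW, hsum] at hII
  simp only [zero_mul, sub_zero, Finset.prod_const_one, he0, pow_zero, one_mul,
    Finset.range_zero, Finset.prod_empty] at hI hII
  have hIcc : ∀ f : ℕ → B, f 1 + ∑ m ∈ Icc 2 N, f m = ∑ m ∈ Icc 1 N, f m := fun f => by
    rw [← Finset.Ico_add_one_right_eq_Icc, ← Finset.Ico_add_one_right_eq_Icc,
      Finset.sum_eq_sum_Ico_succ_bot (show 1 < N + 1 by omega)]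
  have hb1 : b 1 = 1 := by
    rw [hb' 1 (Finset.mem_Icc.mpr ⟨le_rfl, hN⟩)]
    simpa [he0] using hes 0
  have hB : ∑ m ∈ Icc 1 N, z ^ m * q ^ m * b m = (1 - q) * ∑ m ∈ Icc 1 N, e m * (z * q) ^ m := by
    rw [Finset.mul_sum]
    refine Finset.sum_congr rfl fun m hm => ?_
    rw [hb' m hm]
    ring
  have hA : (∑ J ∈ Icc 1 N, w ^ J * q ^ J * a J) * P = (1 - q) *
      ∑ J ∈ Icc 1 N, (e J * ∏ i ∈ range J, (1 - z * q ^ (i + 1))) * (w * q) ^ J := by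
    rw [Finset.mul_sum, Finset.sum_mul]
    refine Finset.sum_congr rfl fun J hJ => ?_
    linear_combination (w ^ J * q ^ J) * ha' J hJ
  -- Since `b 1 = 1`, the term `z q` in `1 + (z - 1) q` is the missing summand `m = 1`.
  have hC := hIcc (fun m => z ^ m * q ^ m * b m)
  simp only [hb1, pow_one, mul_one, hB] at hC
  rw [← hr]
  linear_combination P * W * hC + W * hA + (1 - q) * W * hI + (1 - q) * hII

variable {R : Type*} [CommRing R]

theorem X_pow_dvd_prod_mul_avoidingSum_sub {x : ℕ → R} (hx : x 1 = 1) (N : ℕ) :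
    (X : R⟦X⟧) ^ (N + 1) ∣
      (∏ i ∈ range N, (1 - C (x (i + 1)) * X ^ (i + 1))) * avoidingSum {1} x - (1 - X) := by
  have h1 : avoidingSum {1} x = (1 - X) * avoidingSum ∅ x := by
    rw [← insert_empty_eq, ← one_sub_mul_avoidingSum le_rfl (by simp), hx]
    simp
  have h2 : Icc 1 N = (range N).image (· + 1) := by
    ext i
    simp only [Finset.mem_Icc, Finset.mem_image, Finset.mem_range]
    exact ⟨fun h => ⟨i - 1, by omega, by omega⟩, fun ⟨j, hj, hji⟩ => by omega⟩
  have h3 := prod_mul_avoidingSum (S := ∅) (T := Icc 1 N)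
    (fun a ha => (Finset.mem_Icc.mp ha).1) (Finset.disjoint_empty_right _) x
  rw [Finset.union_empty, h2, Finset.prod_image (fun a _ b _ h => Nat.succ_injective h), ← h2] at h3
  have h4 : (∏ i ∈ range N, (1 - C (x (i + 1)) * X ^ (i + 1))) * avoidingSum {1} x - (1 - X) =
      (1 - X) * (avoidingSum (Icc 1 N) x - 1) := by
    rw [h1, ← h3]
    ring
  rw [h4]
  refine Dvd.dvd.mul_left (X_pow_dvd_iff.mpr fun m hm => ?_) _
  rw [map_sub, coeff_avoidingSum_Icc x (Nat.lt_succ_iff.mp hm), coeff_one, sub_self]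

/-- The Andrews–Garvan product for the crank generating function, modulo `X ^ (N + 1)`. -/
theorem X_pow_dvd_crankSeries_mul_sub (z : Rˣ) {N : ℕ} (hN : 1 ≤ N) :
    (X : R⟦X⟧) ^ (N + 1) ∣
      crankSeries z * ((∏ i ∈ range N, (1 - C (z : R) * X ^ (i + 1))) *
        ∏ i ∈ range N, (1 - C ((z⁻¹ : Rˣ) : R) * X ^ (i + 1))) -
        ∏ i ∈ range N, (1 - X ^ (i + 1)) := by
  -- In the quotient by `X ^ (N + 1)` congruences become equalities and `X` is nilpotent.
  set π := Ideal.Quotient.mk (Ideal.span {(X : R⟦X⟧) ^ (N + 1)}) with hπ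
  have hdvd : ∀ f g : R⟦X⟧, X ^ (N + 1) ∣ f - g ↔ π f = π g := fun f g => by
    rw [hπ, Ideal.Quotient.mk_eq_mk_iff_sub_mem, Ideal.mem_span_singleton]
  have hq : π X ^ (N + 1) = 0 := by
    rw [← map_pow, hπ, Ideal.Quotient.eq_zero_iff_mem]
    exact Ideal.mem_span_singleton_self _
  have hzw : π (C (z : R)) * π (C ((z⁻¹ : Rˣ) : R)) = 1 := by
    rw [← map_mul, ← map_mul, Units.mul_inv, map_one, map_one]
  have hF := X_pow_dvd_crankSeries_sub z N hN
  rw [hdvd] at hF ⊢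
  have h1 : ∑ m ∈ Icc 2 N, partitionSum
      (fun s => if s.count 1 = 0 ∧ s.sup = m then (z : R) ^ m else 0) =
      ∑ m ∈ Icc 2 N, C ((z : R) ^ m) * X ^ m * avoidingSum {1} (fun i => if i ≤ m then 1 else 0) :=
    Finset.sum_congr rfl fun m hm => partitionSum_largest _ (Finset.mem_Icc.mp hm).1
  have h2 : ∑ J ∈ Icc 1 N, partitionSum (fun s => if s.count 1 = J then
        ((z⁻¹ : Rˣ) : R) ^ J * (z : R) ^ s.countP (J < ·) else 0) =
      ∑ J ∈ Icc 1 N, C (((z⁻¹ : Rˣ) : R) ^ J) * X ^ J *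
        avoidingSum {1} (fun i => if i ≤ J then 1 else (z : R)) :=
    Finset.sum_congr rfl fun J hJ => partitionSum_ones _ _ (Finset.mem_Icc.mp hJ).1
  -- `y = z` serves the partitions with ones, `y = 0` those without.
  have hav : ∀ y : R, ∀ J ∈ Icc 1 N, (∏ i ∈ range J, (1 - π X ^ (i + 1))) *
      (∏ i ∈ Ico J N, (1 - π (C y) * π X ^ (i + 1))) *
        π (avoidingSum {1} (fun i => if i ≤ J then 1 else y)) = 1 - π X := by
    intro y J hJ
    have hJ' := Finset.mem_Icc.mp hJ
    have h3 := (hdvd _ _).mp (X_pow_dvd_prod_mul_avoidingSum_sub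
      (x := fun i => if i ≤ J then 1 else y) (if_pos hJ'.1) N)
    rw [← Finset.prod_range_mul_prod_Ico _ hJ'.2] at h3
    simp only [map_mul, map_sub, map_one, map_prod, map_pow] at h3
    rw [← h3]
    congr 2
    · refine Finset.prod_congr rfl fun i hi => ?_
      rw [if_pos (show i + 1 ≤ J from Finset.mem_range.mp hi), map_one, map_one, one_mul]
    · refine Finset.prod_congr rfl fun i hi => ?_
      rw [if_neg (by have := (Finset.mem_Ico.mp hi).1; omega)]
  have key := crank_product_of_nilpotent hq hzw hN (hav _) (b := fun m =>
    π (avoidingSum {1} (fun i => if i ≤ m then 1 else 0))) (fun m hm => by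
      have := hav 0 m hm
      simpa using this)
  rw [h1, h2] at hF
  rw [map_mul, hF]
  simp only [map_mul, map_add, map_sub, map_one, map_prod, map_pow, map_sum] at key ⊢
  exact key

end Product

/-! ### Logarithmic derivative in the crank variable -/

section LogDerivative

variable {K R : Type*} [CommRing K] [CommRing R] [Algebra K R]

/-- A derivation of `R`, applied to the coefficients of a power series. -/
noncomputable def coeffDerivation (d : Derivation K R R) : Derivation K R⟦X⟧ R⟦X⟧ :=
  Derivation.mk'
    { toFun := fun f => PowerSeries.mk fun n => d (coeff n f)
      map_add' := fun f g => by ext n; simp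
      map_smul' := fun c f => by
        have h : ∀ (g : R⟦X⟧) (n : ℕ), coeff n (c • g) = c • coeff n g := fun g n => by
          rw [Algebra.smul_def, PowerSeries.algebraMap_apply, coeff_C_mul, ← Algebra.smul_def]
        ext n
        rw [coeff_mk, h f, d.map_smul, RingHom.id_apply, h, coeff_mk] }
    (fun f g => by
      ext n
      simp only [LinearMap.coe_mk, AddHom.coe_mk, coeff_mk, coeff_mul, map_sum, Derivation.leibniz,
        smul_eq_mul, map_add, Finset.sum_add_distrib]
      congr 1
      rw [← Finset.Nat.sum_antidiagonal_swap]
      rfl)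

theorem coeff_coeffDerivation (d : Derivation K R R) (f : R⟦X⟧) (n : ℕ) :
    coeff n (coeffDerivation d f) = d (coeff n f) := by
  simp [coeffDerivation]

theorem coeffDerivation_C (d : Derivation K R R) (r : R) :
    coeffDerivation d (C r) = C (d r) := by
  ext n
  rw [coeff_coeffDerivation, coeff_C, coeff_C]
  split_ifs <;> simp

theorem coeffDerivation_X_pow (d : Derivation K R R) (n : ℕ) :
    coeffDerivation d (X ^ n) = 0 := by
  ext m
  rw [coeff_coeffDerivation, coeff_X_pow]
  split_ifs <;> simp

/-- The series `∑_{m ≥ 1} z ^ m X ^ {i m}`. -/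
noncomputable def geomTail (z : R) (i : ℕ) : R⟦X⟧ :=
  PowerSeries.mk fun n => if i ∣ n ∧ n ≠ 0 then z ^ (n / i) else 0

theorem one_sub_mul_geomTail (z : R) {i : ℕ} (hi : 1 ≤ i) :
    (1 - C z * X ^ i) * geomTail z i = C z * X ^ i := by
  ext n
  rw [sub_mul, one_mul, map_sub, mul_assoc, coeff_C_mul, coeff_C_mul, coeff_X_pow_mul', coeff_X_pow,
    geomTail, coeff_mk]
  rcases lt_trichotomy n i with h | rfl | h
  · have : ¬ (i ∣ n ∧ n ≠ 0) := fun hh => by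
      have := Nat.le_of_dvd (Nat.pos_of_ne_zero hh.2) hh.1
      omega
    simp [this, not_le.mpr h, h.ne]
  · simp [Nat.div_self hi, (show n ≠ 0 by omega)]
  · rw [if_pos h.le, coeff_mk, if_neg h.ne']
    have h0 : n ≠ 0 := by omega
    have h1 : n - i ≠ 0 := by omega
    have h2 : i ∣ n - i ↔ i ∣ n := Nat.dvd_sub_iff_left h.le dvd_rfl
    simp only [h0, h1, ne_eq, not_false_eq_true, and_true, h2]
    by_cases hd : i ∣ n
    · obtain ⟨m, rfl⟩ := hd
      obtain ⟨m, rfl⟩ : ∃ k, m = k + 1 := ⟨m - 1, by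
        rcases m with _ | m
        · simp at h0
        · simp⟩
      rw [show i * (m + 1) - i = i * m by rw [mul_add, mul_one, Nat.add_sub_cancel],
        Nat.mul_div_cancel_left _ hi, Nat.mul_div_cancel_left _ hi]
      simp [pow_succ, mul_comm]
    · simp [hd]

/-- Here `ε` is `1` for `z`, `-1` for `z⁻¹`, and `0` for the numerator, where `z` is replaced by
`1`. -/
theorem coeffDerivation_prod (d : Derivation K R R) {z ε : R} (hz : d z = ε * z) (N : ℕ) :
    coeffDerivation d (∏ i ∈ range N, (1 - C z * X ^ (i + 1))) =
      -((∏ i ∈ range N, (1 - C z * X ^ (i + 1))) * C ε * ∑ i ∈ range N, geomTail z (i + 1)) := by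
  induction N with
  | zero => simp
  | succ N ih =>
    rw [Finset.prod_range_succ, Finset.sum_range_succ, Derivation.leibniz, ih, map_sub,
      Derivation.leibniz, coeffDerivation_X_pow, coeffDerivation_C, hz]
    simp only [smul_eq_mul, map_mul, Derivation.map_one_eq_zero]
    linear_combination (∏ i ∈ range N, (1 - C z * X ^ (i + 1))) * C ε *
      one_sub_mul_geomTail z (show 1 ≤ N + 1 by omega)

theorem coeff_sum_geomTail (z : R) {n N : ℕ} (h : n ≤ N) :
    coeff n (∑ i ∈ range N, geomTail z (i + 1)) = ∑ m ∈ n.divisors, z ^ m := by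
  rw [map_sum]
  simp only [geomTail, coeff_mk]
  rcases Nat.eq_zero_or_pos n with rfl | hn
  · simp
  rw [← Nat.sum_div_divisors n (fun m => z ^ m), ← Finset.sum_filter]
  refine Finset.sum_bij (fun i _ => i + 1) ?_ ?_ ?_ ?_
  · intro i hi
    exact Nat.mem_divisors.mpr (Finset.mem_filter.mp hi).2
  · intro i _ j _ hij
    exact Nat.succ_injective hij
  · intro m hm
    have h1 := Nat.mem_divisors.mp hm
    have h2 := Nat.le_of_dvd hn h1.1
    have h3 : m ≠ 0 := by rintro rfl; simp at hm
    refine ⟨m - 1, Finset.mem_filter.mpr ⟨Finset.mem_range.mpr (by omega), ?_⟩, by omega⟩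
    rwa [Nat.sub_add_cancel (by omega)]
  · intro i _
    rfl

/-- The logarithmic derivative of the crank generating function. -/
theorem coeffDerivation_crankSeries (d : Derivation K R R) {z : Rˣ} (hz : d (z : R) = z) :
    coeffDerivation d (crankSeries z) = crankSeries z * PowerSeries.mk fun n =>
      ∑ m ∈ n.divisors, ((z : R) ^ m - ((z⁻¹ : Rˣ) : R) ^ m) := by
  have hz' : d ((z⁻¹ : Rˣ) : R) = -1 * ((z⁻¹ : Rˣ) : R) := by
    have h1 : (z : R) * ((z⁻¹ : Rˣ) : R) = 1 := Units.mul_inv z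
    have h2 := congrArg d h1
    rw [Derivation.leibniz, hz, Derivation.map_one_eq_zero, smul_eq_mul, smul_eq_mul] at h2
    linear_combination ((z⁻¹ : Rˣ) : R) * h2 -
      (d ((z⁻¹ : Rˣ) : R) + ((z⁻¹ : Rˣ) : R)) * h1
  ext n
  set N := n + 1 with hN
  set F := crankSeries z with hF
  set P : R⟦X⟧ := ∏ i ∈ range N, (1 - C (z : R) * X ^ (i + 1)) with hP
  set W : R⟦X⟧ := ∏ i ∈ range N, (1 - C ((z⁻¹ : Rˣ) : R) * X ^ (i + 1)) with hW
  set S : R⟦X⟧ := ∑ i ∈ range N, geomTail (z : R) (i + 1) -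
    ∑ i ∈ range N, geomTail ((z⁻¹ : Rˣ) : R) (i + 1) with hS
  obtain ⟨h, hh⟩ := X_pow_dvd_crankSeries_mul_sub z (show 1 ≤ N by omega)
  have hQ : coeffDerivation d (∏ i ∈ range N, (1 - (X : R⟦X⟧) ^ (i + 1))) = 0 := by
    have := coeffDerivation_prod d (z := 1) (ε := 0) (by simp) N
    simpa using this
  have hD := congrArg (coeffDerivation d) hh
  rw [map_sub, hQ, Derivation.leibniz, Derivation.leibniz, Derivation.leibniz,
    coeffDerivation_prod d (hz.trans (one_mul _).symm), coeffDerivation_prod d hz',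
    coeffDerivation_X_pow, ← hP, ← hW, ← hF] at hD
  simp only [smul_eq_mul, map_one, map_neg] at hD
  -- The derivation treats `X` as a constant, so differentiating the congruence preserves its
  -- modulus.
  have hdvd : (X : R⟦X⟧) ^ (N + 1) ∣ P * W * (coeffDerivation d F - F * S) := by
    refine ⟨coeffDerivation d h, ?_⟩
    rw [hS]
    linear_combination hD
  have hu : IsUnit (P * W) := by
    rw [PowerSeries.isUnit_iff_constantCoeff, map_mul, hP, hW, map_prod, map_prod]
    simp
  rw [IsUnit.dvd_mul_left hu, X_pow_dvd_iff] at hdvd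
  have hc := hdvd n (by omega)
  rw [map_sub, sub_eq_zero] at hc
  rw [hc, coeff_mul, coeff_mul]
  refine Finset.sum_congr rfl fun x hx => ?_
  have hx2 : x.2 ≤ N := by
    have := Finset.HasAntidiagonal.mem_antidiagonal.mp hx
    omega
  rw [coeff_mk, hS, map_sub, coeff_sum_geomTail _ hx2, coeff_sum_geomTail _ hx2,
    Finset.sum_sub_distrib]

end LogDerivative

/-! ### Crank moments from `z = exp u` -/

section Moments

/-- The unit `exp(u)` of `ℂ⟦u⟧`. -/
noncomputable def expUnit : (ℂ⟦X⟧)ˣ where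
  val := exp ℂ
  inv := evalNegHom (exp ℂ)
  val_inv := exp_mul_exp_neg_eq_one
  inv_val := by rw [mul_comm, exp_mul_exp_neg_eq_one]

theorem coeff_expUnit_pow (m k : ℕ) :
    coeff k ((expUnit : ℂ⟦X⟧) ^ m) = (m : ℂ) ^ k / (k.factorial : ℂ) := by
  rw [expUnit, exp_pow_eq_rescale_exp, coeff_rescale, coeff_exp]
  simp [div_eq_mul_inv]

theorem coeff_expUnit_inv_pow (m k : ℕ) :
    coeff k (((expUnit⁻¹ : (ℂ⟦X⟧)ˣ) : ℂ⟦X⟧) ^ m) = (-(m : ℂ)) ^ k / (k.factorial : ℂ) := by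
  change coeff k (evalNegHom (exp ℂ) ^ m) = _
  rw [← map_pow, evalNegHom, coeff_rescale]
  change (-1) ^ k * coeff k ((expUnit : ℂ⟦X⟧) ^ m) = _
  rw [coeff_expUnit_pow, neg_pow (m : ℂ)]
  ring

theorem coeff_expUnit_zpow (c : ℤ) (k : ℕ) :
    coeff k ((expUnit ^ c : (ℂ⟦X⟧)ˣ) : ℂ⟦X⟧) = (c : ℂ) ^ k / (k.factorial : ℂ) := by
  obtain ⟨m, rfl | rfl⟩ := c.eq_nat_or_neg
  · rw [zpow_natCast, Units.val_pow_eq_pow_val, coeff_expUnit_pow, Int.cast_natCast]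
  · rw [zpow_neg, zpow_natCast, ← inv_pow, Units.val_pow_eq_pow_val, coeff_expUnit_inv_pow,
      Int.cast_neg, Int.cast_natCast]

theorem crankMomentCoeff_eq_sum {n : ℕ} (hn : n ≠ 1) (k : ℕ) :
    crankMomentCoeff k n = ∑ p : n.Partition, crank p ^ k := by
  rw [crankMomentCoeff, Finset.sum_comp (fun m : ℤ => m ^ k) (fun p : n.Partition => crank p),
    finsum_eq_sum_of_support_subset (s := univ.image fun p : n.Partition => crank p)]
  · refine Finset.sum_congr rfl fun m _ => ?_
    rw [crankCount, if_neg hn, nsmul_eq_mul, mul_comm]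
  · intro m hm
    rw [Function.mem_support, crankCount, if_neg hn] at hm
    have h := Nat.cast_ne_zero.mp (right_ne_zero_of_mul hm)
    obtain ⟨p, hp⟩ := Finset.card_ne_zero.mp h
    exact Finset.mem_coe.mpr (Finset.mem_image.mpr ⟨p, Finset.mem_univ p, (Finset.mem_filter.mp hp).2⟩)

theorem crankMomentCoeff_one (k : ℕ) :
    crankMomentCoeff k 1 = 1 + (-1) ^ k - 0 ^ k := by
  rw [crankMomentCoeff, finsum_eq_sum_of_support_subset (s := {0, 1, -1})]
  · rw [Finset.sum_insert (by decide), Finset.sum_insert (by decide), Finset.sum_singleton]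
    simp [crankCount]
    ring
  · intro m hm
    by_contra h
    simp only [Finset.coe_insert, Finset.coe_singleton, Set.mem_insert_iff,
      Set.mem_singleton_iff, not_or] at h
    simp [crankCount, h.1, h.2.1, h.2.2] at hm

theorem coeff_coeff_crankSeries_expUnit (k n : ℕ) :
    coeff k (coeff n (crankSeries expUnit)) =
      (crankMomentCoeff k n : ℂ) / (k.factorial : ℂ) := by
  rw [crankSeries, coeff_mk]
  split_ifs with h
  · subst h
    have h1 := coeff_expUnit_zpow 1 k
    have h2 := coeff_expUnit_zpow (-1) k
    have h3 := coeff_expUnit_zpow 0 k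
    rw [zpow_one] at h1
    rw [zpow_neg_one] at h2
    rw [zpow_zero, Units.val_one] at h3
    rw [map_sub, map_add, h1, h2, h3, crankMomentCoeff_one]
    push_cast
    ring
  · rw [map_sum, crankMomentCoeff_eq_sum h]
    push_cast
    rw [Finset.sum_div]
    exact Finset.sum_congr rfl fun p _ => coeff_expUnit_zpow _ _

theorem crankMomentCoeff_zero (n : ℕ) : crankMomentCoeff 0 n = Fintype.card n.Partition := by
  by_cases h : n = 1
  · subst h
    rw [crankMomentCoeff_one]
    simp
  · simp [crankMomentCoeff_eq_sum h]

/-- The coefficients `∑_{m ∣ n} (m ^ i - (-m) ^ i)` of the logarithmic derivative of the crank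
generating function. -/
noncomputable def signedDivisorSum (i n : ℕ) : ℂ :=
  ∑ m ∈ n.divisors, ((m : ℂ) ^ i - (-(m : ℂ)) ^ i)

theorem signedDivisorSum_of_odd {i : ℕ} (hi : Odd i) (n : ℕ) :
    signedDivisorSum i n = 2 * (ArithmeticFunction.sigma i n : ℂ) := by
  rw [signedDivisorSum, ArithmeticFunction.sigma_apply]
  push_cast
  rw [Finset.mul_sum]
  refine Finset.sum_congr rfl fun m _ => ?_
  rw [hi.neg_pow]
  ring

theorem signedDivisorSum_of_even {i : ℕ} (hi : Even i) (n : ℕ) : signedDivisorSum i n = 0 :=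
  Finset.sum_eq_zero fun m _ => by rw [hi.neg_pow, sub_self]

/-- This compares the coefficients of `uᵏ` and of the `n`-th power of the outer variable in the
logarithmic derivative at `z = exp u`, where `d/du` fixes `z`. -/
theorem crankMomentCoeff_succ (k n : ℕ) :
    (crankMomentCoeff (k + 1) n : ℂ) / (k.factorial : ℂ) =
      ∑ x ∈ antidiagonal k, ∑ y ∈ antidiagonal n,
        (crankMomentCoeff x.1 y.1 : ℂ) / (x.1.factorial : ℂ) *
          (signedDivisorSum x.2 y.2 / (x.2.factorial : ℂ)) := by
  have hz : derivative ℂ (expUnit : ℂ⟦X⟧) = (expUnit : ℂ⟦X⟧) := derivative_exp ℂ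
  have h := congrArg (fun f => coeff k (coeff n f)) (coeffDerivation_crankSeries (derivative ℂ) hz)
  simp only [coeff_coeffDerivation, coeff_derivative, coeff_coeff_crankSeries_expUnit] at h
  rw [coeff_mul, map_sum] at h
  simp only [coeff_mul, coeff_mk, map_sum, map_sub, coeff_expUnit_pow, coeff_expUnit_inv_pow,
    coeff_coeff_crankSeries_expUnit] at h
  rw [Finset.sum_comm] at h
  have hf : (crankMomentCoeff (k + 1) n : ℂ) / (k.factorial : ℂ) =
      (crankMomentCoeff (k + 1) n : ℂ) / ((k + 1).factorial : ℂ) * (k + 1) := by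
    have h1 : (k.factorial : ℂ) ≠ 0 := by exact_mod_cast k.factorial_ne_zero
    have h2 : (k : ℂ) + 1 ≠ 0 := by exact_mod_cast k.succ_ne_zero
    rw [Nat.factorial_succ]
    push_cast
    field_simp
  rw [hf, h]
  refine Finset.sum_congr rfl fun x _ => Finset.sum_congr rfl fun y _ => ?_
  simp only [signedDivisorSum, Finset.sum_div, sub_div]

end Moments

/-! ### Euler's product as a convergent series -/

section PartitionGenerating

theorem one_sub_mul_avoidingSum_le (N : ℕ) {𝕜 : Type*} [Field 𝕜] :
    (1 - X ^ (N + 1)) * avoidingSum ∅ (fun i => if i ≤ N + 1 then (1 : 𝕜) else 0) =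
      avoidingSum ∅ (fun i => if i ≤ N then (1 : 𝕜) else 0) := by
  have h := one_sub_mul_avoidingSum (S := ∅) (Nat.succ_pos N) (by simp)
    (fun i => if i ≤ N + 1 then (1 : 𝕜) else 0)
  simp only [Nat.succ_eq_add_one, le_refl, if_true, map_one, one_mul] at h
  rw [h, avoidingSum, avoidingSum]
  congr 1
  funext s
  by_cases hs : N + 1 ∈ s
  · rw [if_neg (by simp [hs])]
    have : (0 : 𝕜) ∈ s.map (fun i => if i ≤ N then (1 : 𝕜) else 0) :=
      Multiset.mem_map.mpr ⟨N + 1, hs, by simp⟩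
    simp [Multiset.prod_eq_zero this]
  · rw [if_pos (by simp [hs]), if_pos (by simp)]
    congr 1
    refine Multiset.map_congr rfl fun i hi => ?_
    have : i ≠ N + 1 := fun h => hs (h ▸ hi)
    congr 1
    exact propext (by omega)

theorem coeff_avoidingSum_le {𝕜 : Type*} [Field 𝕜] (N n : ℕ) :
    coeff n (avoidingSum ∅ (fun i => if i ≤ N then (1 : 𝕜) else 0)) =
      ((univ.filter fun p : n.Partition => ∀ i ∈ p.parts, i ≤ N).card : 𝕜) := by
  rw [avoidingSum, coeff_partitionSum, Finset.card_filter]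
  push_cast
  refine Finset.sum_congr rfl fun p _ => ?_
  rw [if_pos (by simp)]
  split_ifs with h
  · exact Multiset.prod_eq_one fun x hx => by
      obtain ⟨i, hi, rfl⟩ := Multiset.mem_map.mp hx
      rw [if_pos (h i hi)]
  · push Not at h
    obtain ⟨i, hi, hiN⟩ := h
    exact Multiset.prod_eq_zero (Multiset.mem_map.mpr ⟨i, hi, if_neg (not_le.mpr hiN)⟩)

variable {𝕜 : Type*} [RCLike 𝕜]

theorem hasSum_coeff_mul {f g : 𝕜⟦X⟧} {q a b : 𝕜} (hf : HasSum (fun n => coeff n f * q ^ n) a)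
    (hg : HasSum (fun n => coeff n g * q ^ n) b) :
    HasSum (fun n => coeff n (f * g) * q ^ n) (a * b) := by
  have hf' := summable_norm_iff.mpr hf.summable
  have hg' := summable_norm_iff.mpr hg.summable
  have h : (fun n => coeff n (f * g) * q ^ n) = fun n => ∑ y ∈ antidiagonal n,
      (coeff y.1 f * q ^ y.1) * (coeff y.2 g * q ^ y.2) := by
    funext n
    rw [coeff_mul, Finset.sum_mul]
    refine Finset.sum_congr rfl fun y hy => ?_
    rw [← Finset.HasAntidiagonal.mem_antidiagonal.mp hy, pow_add]
    ring
  rw [h, ← hf.tsum_eq, ← hg.tsum_eq,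
    tsum_mul_tsum_eq_tsum_sum_antidiagonal_of_summable_norm hf' hg']
  exact (summable_norm_sum_mul_antidiagonal_of_summable_norm hf' hg').of_norm.hasSum

theorem hasSum_coeff_geometric {q : 𝕜} (hq : ‖q‖ < 1) {i : ℕ} (hi : 1 ≤ i) :
    HasSum (fun n => coeff n (1 + geomTail (1 : 𝕜) i) * q ^ n) (1 - q ^ i)⁻¹ := by
  have hqi : ‖q ^ i‖ < 1 := by
    rw [norm_pow]
    exact pow_lt_one₀ (norm_nonneg q) hq (by omega)
  have h := hasSum_geometric_of_norm_lt_one hqi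
  have hinj : Function.Injective fun m : ℕ => i * m :=
    fun a b hab => Nat.eq_of_mul_eq_mul_left hi hab
  rw [← Function.Injective.hasSum_iff hinj]
  · convert h using 1
    funext m
    have : coeff (i * m) (1 + geomTail (1 : 𝕜) i) = 1 := by
      rw [map_add, coeff_one, geomTail, coeff_mk]
      by_cases h0 : m = 0 <;> simp [h0, (show i ≠ 0 by omega)]
    rw [Function.comp_apply, this, one_mul, pow_mul]
  · intro n hn
    have hd : ¬ i ∣ n := fun ⟨m, hm⟩ => hn ⟨m, hm.symm⟩
    have h0 : n ≠ 0 := by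
      rintro rfl
      exact hd (dvd_zero i)
    simp [geomTail, coeff_one, hd, h0]

theorem hasSum_card_restricted {q : 𝕜} (hq : ‖q‖ < 1) (N : ℕ) :
    HasSum (fun n : ℕ => ((univ.filter fun p : n.Partition => ∀ i ∈ p.parts, i ≤ N).card : 𝕜) *
      q ^ n) (∏ i ∈ range N, (1 - q ^ (i + 1)))⁻¹ := by
  simp only [← coeff_avoidingSum_le]
  induction N with
  | zero =>
    have : avoidingSum ∅ (fun i => if i ≤ 0 then (1 : 𝕜) else 0) = 1 := by
      ext n
      rw [coeff_avoidingSum_le, coeff_one]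
      rcases Nat.eq_zero_or_pos n with rfl | hn
      · simp
      · rw [if_neg hn.ne', Nat.cast_eq_zero, Finset.card_eq_zero, Finset.filter_eq_empty_iff]
        intro p _ hp
        have h0 : p.parts = 0 := Multiset.eq_zero_of_forall_notMem fun i hi =>
          (p.parts_pos hi).ne' (Nat.le_zero.mp (hp i hi))
        have := p.parts_sum
        rw [h0, Multiset.sum_zero] at this
        omega
    rw [this]
    convert hasSum_ite_eq (0 : ℕ) (1 : 𝕜) using 1
    · funext n
      rw [coeff_one]
      split_ifs with h <;> simp [h]
    · simp
  | succ N ih =>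
    have h1 : avoidingSum ∅ (fun i => if i ≤ N + 1 then (1 : 𝕜) else 0) =
        avoidingSum ∅ (fun i => if i ≤ N then (1 : 𝕜) else 0) *
          (1 + geomTail (1 : 𝕜) (N + 1)) := by
      have h2 := one_sub_mul_geomTail (1 : 𝕜) (show 1 ≤ N + 1 by omega)
      rw [map_one, one_mul] at h2
      rw [← one_sub_mul_avoidingSum_le N]
      linear_combination (-avoidingSum ∅ (fun i => if i ≤ N + 1 then (1 : 𝕜) else 0)) * h2
    rw [h1, Finset.prod_range_succ, mul_inv]
    exact hasSum_coeff_mul ih (hasSum_coeff_geometric hq (Nat.succ_pos N))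

theorem card_restricted_of_le {n N : ℕ} (h : n ≤ N) :
    (univ.filter fun p : n.Partition => ∀ i ∈ p.parts, i ≤ N).card = Fintype.card n.Partition := by
  rw [Finset.filter_true_of_mem fun p _ i hi => (p.le_of_mem_parts hi).trans h, Finset.card_univ]

theorem tprod_one_sub_pow_ne_zero {q : 𝕜} (hq : ‖q‖ < 1) : ∏' n : ℕ, (1 - q ^ (n + 1)) ≠ 0 := by
  simp only [sub_eq_add_neg]
  refine tprod_one_add_ne_zero_of_summable (fun i h => ?_) ?_
  · rw [← sub_eq_add_neg, sub_eq_zero] at h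
    have h1 := pow_lt_one₀ (norm_nonneg q) hq i.succ_ne_zero
    rw [← norm_pow, ← Nat.add_one, ← h, norm_one] at h1
    exact lt_irrefl _ h1
  · simpa using (summable_nat_add_iff 1).mpr (summable_geometric_of_lt_one (norm_nonneg q) hq)

theorem tendsto_inv_prod_one_sub_pow {q : 𝕜} (hq : ‖q‖ < 1) :
    Filter.Tendsto (fun N => (∏ i ∈ range N, (1 - q ^ (i + 1)))⁻¹) Filter.atTop
      (nhds (∏' n : ℕ, (1 - q ^ (n + 1)))⁻¹) := by
  refine Filter.Tendsto.inv₀ (Multipliable.hasProd ?_).tendsto_prod_nat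
    (tprod_one_sub_pow_ne_zero hq)
  simp only [sub_eq_add_neg]
  refine multipliable_one_add_of_summable ?_
  simpa using (summable_nat_add_iff 1).mpr (summable_geometric_of_lt_one (norm_nonneg q) hq)

/-- The terms below `M` only involve partitions with parts at most `M`, so the partial sum is
bounded by a finite product, and these products converge. -/
theorem summable_card_partition {r : ℝ} (h0 : 0 ≤ r) (h1 : r < 1) :
    Summable fun n : ℕ => (Fintype.card n.Partition : ℝ) * r ^ n := by
  have hr : ‖r‖ < 1 := by rwa [Real.norm_of_nonneg h0]
  obtain ⟨c, hc⟩ := (tendsto_inv_prod_one_sub_pow hr).bddAbove_range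
  refine summable_of_sum_range_le (c := c) (fun n => by positivity) fun M => ?_
  refine le_trans ?_ (hc ⟨M, rfl⟩)
  have h := hasSum_card_restricted hr M
  refine le_trans (Finset.sum_le_sum fun n hn => ?_)
    (sum_le_hasSum (range M) (fun n _ => by positivity) h)
  rw [card_restricted_of_le (Finset.mem_range.mp hn).le]

/-- Euler's product for the partition generating function. -/
theorem hasSum_card_partition {q : 𝕜} (hq : ‖q‖ < 1) :
    HasSum (fun n : ℕ => (Fintype.card n.Partition : 𝕜) * q ^ n)
      (∏' n : ℕ, (1 - q ^ (n + 1)))⁻¹ := by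
  have hs := summable_card_partition (norm_nonneg q) hq
  have hs' : Summable fun n : ℕ => (Fintype.card n.Partition : 𝕜) * q ^ n :=
    Summable.of_norm (by simpa using hs)
  -- For fixed `n` the restricted count is constant once `N ≥ n`, and it is dominated by the full
  -- count.
  have h := tendsto_tsum_of_dominated_convergence (𝓕 := Filter.atTop)
    (f := fun N n => ((univ.filter fun p : n.Partition => ∀ i ∈ p.parts, i ≤ N).card : 𝕜) * q ^ n)
    (g := fun n => (Fintype.card n.Partition : 𝕜) * q ^ n) hs
    (fun n => tendsto_const_nhds.congr' (Filter.eventually_atTop.mpr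
      ⟨n, fun N hN => by
        simp only [card_restricted_of_le hN]⟩))
    (Filter.Eventually.of_forall fun N n => by
      rw [norm_mul, norm_pow, RCLike.norm_natCast]
      gcongr
      exact Finset.card_le_univ _)
  simp only [(hasSum_card_restricted hq _).tsum_eq] at h
  rw [← tendsto_nhds_unique h (tendsto_inv_prod_one_sub_pow hq)]
  exact hs'.hasSum

end PartitionGenerating

/-! ### Convergence and the differential equation -/

section Analytic

theorem expWeight_congr {K : Type*} [Field K] [CharZero K] {c c' : ℕ → K}
    (h : ∀ j, 1 ≤ j → c j = c' j) {n : ℕ} (p : n.Partition) :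
    expWeight c p.parts = expWeight c' p.parts :=
  Finset.prod_congr rfl fun j hj => by
    rw [h j (p.parts_pos (Multiset.mem_toFinset.mp hj))]

variable {q : ℂ}

theorem summable_sigma_mul_pow (hq : ‖q‖ < 1) (k : ℕ) :
    Summable fun n : ℕ => (ArithmeticFunction.sigma k n : ℂ) * q ^ n := by
  refine Summable.of_norm_bounded (summable_norm_pow_mul_geometric_of_norm_lt_one (k + 1) hq)
    fun n => ?_
  simp only [norm_mul, Complex.norm_natCast, norm_pow]
  gcongr
  exact_mod_cast ArithmeticFunction.sigma_le_pow_succ k n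

theorem summable_signedDivisorSum (hq : ‖q‖ < 1) (i : ℕ) :
    Summable fun n : ℕ => signedDivisorSum i n * q ^ n := by
  rcases Nat.even_or_odd i with hi | hi
  · simp [signedDivisorSum_of_even hi]
  · simpa [signedDivisorSum_of_odd hi, mul_assoc] using (summable_sigma_mul_pow hq i).mul_left 2

theorem hasSum_crankMomentCoeff_succ (hq : ‖q‖ < 1) {k : ℕ}
    (h : ∀ j ≤ k, Summable fun n : ℕ => (crankMomentCoeff j n : ℂ) * q ^ n) :
    HasSum (fun n : ℕ => (crankMomentCoeff (k + 1) n : ℂ) / (k.factorial : ℂ) * q ^ n)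
      (∑ x ∈ antidiagonal k, crankMoment x.1 q / (x.1.factorial : ℂ) *
        ((∑' n : ℕ, signedDivisorSum x.2 n * q ^ n) / (x.2.factorial : ℂ))) := by
  simp only [crankMomentCoeff_succ, Finset.sum_mul]
  refine hasSum_sum fun x hx => ?_
  have hx1 : x.1 ≤ k := by
    have := Finset.HasAntidiagonal.mem_antidiagonal.mp hx
    omega
  have hf : HasSum (fun n => coeff n (PowerSeries.mk fun n =>
      (crankMomentCoeff x.1 n : ℂ) / (x.1.factorial : ℂ)) * q ^ n)
      (crankMoment x.1 q / (x.1.factorial : ℂ)) := by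
    simp only [coeff_mk, div_mul_eq_mul_div]
    exact (h x.1 hx1).hasSum.div_const _
  have hg : HasSum (fun n => coeff n (PowerSeries.mk fun n =>
      signedDivisorSum x.2 n / (x.2.factorial : ℂ)) * q ^ n)
      ((∑' n : ℕ, signedDivisorSum x.2 n * q ^ n) / (x.2.factorial : ℂ)) := by
    simp only [coeff_mk, div_mul_eq_mul_div]
    exact (summable_signedDivisorSum hq x.2).hasSum.div_const _
  have hfg := hasSum_coeff_mul hf hg
  simp only [coeff_mul, coeff_mk, Finset.sum_mul] at hfg
  exact hfg

/-- No bound on the crank is needed: the recurrence writes each moment series as a finite sum of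
Cauchy products of lower ones with divisor series, starting from Euler's product. -/
theorem summable_crankMomentCoeff (hq : ‖q‖ < 1) (k : ℕ) :
    Summable fun n : ℕ => (crankMomentCoeff k n : ℂ) * q ^ n := by
  induction k using Nat.strong_induction_on with
  | _ k ih =>
    rcases k with _ | k
    · simpa [crankMomentCoeff_zero] using (hasSum_card_partition hq).summable
    · have h := (hasSum_crankMomentCoeff_succ hq fun j hj => ih j (Nat.lt_succ_of_le hj)).summable
      refine (h.mul_left (k.factorial : ℂ)).congr fun n => ?_
      have : (k.factorial : ℂ) ≠ 0 := by exact_mod_cast k.factorial_ne_zero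
      field_simp

theorem crankMoment_succ (hq : ‖q‖ < 1) (k : ℕ) :
    crankMoment (k + 1) q / (k.factorial : ℂ) =
      ∑ x ∈ antidiagonal k, crankMoment x.1 q / (x.1.factorial : ℂ) *
        ((∑' n : ℕ, signedDivisorSum x.2 n * q ^ n) / (x.2.factorial : ℂ)) := by
  refine HasSum.unique ?_
    (hasSum_crankMomentCoeff_succ hq fun j _ => summable_crankMomentCoeff hq j)
  simp only [div_mul_eq_mul_div]
  exact (summable_crankMomentCoeff hq (k + 1)).hasSum.div_const _

theorem normalizedCrankMoment_zero (hq : ‖q‖ < 1) : normalizedCrankMoment 0 q = 1 := by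
  have h := (hasSum_card_partition hq).tsum_eq
  rw [normalizedCrankMoment, crankMoment, eulerProduct]
  simp only [crankMomentCoeff_zero, Int.cast_natCast]
  rw [h, mul_inv_cancel₀ (tprod_one_sub_pow_ne_zero hq)]

theorem tsum_signedDivisorSum_of_odd (hq : ‖q‖ < 1) {i : ℕ} (hi : Odd i) :
    ∑' n : ℕ, signedDivisorSum i n * q ^ n =
      2 * ∑' n : ℕ, (ArithmeticFunction.sigma i (n + 1) : ℂ) * q ^ (n + 1) := by
  simp only [signedDivisorSum_of_odd hi, mul_assoc]
  rw [tsum_mul_left, (summable_sigma_mul_pow hq i).tsum_eq_zero_add]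
  simp

/-- The even crank moments in terms of the divisor sums `Φ_j = ∑ σ_{2j-1}(n) q ^ n`. -/
theorem crankMoment_even_succ (hq : ‖q‖ < 1) (m : ℕ) :
    crankMoment (2 * (m + 1)) q / ((2 * m + 1).factorial : ℂ) =
      ∑ x ∈ antidiagonal m, 2 * (∑' n : ℕ, (ArithmeticFunction.sigma (2 * x.1 + 1) (n + 1) : ℂ) *
        q ^ (n + 1)) / ((2 * x.1 + 1).factorial : ℂ) *
          (crankMoment (2 * x.2) q / ((2 * x.2).factorial : ℂ)) := by
  rw [show 2 * (m + 1) = (2 * m + 1) + 1 by ring, crankMoment_succ hq]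
  symm
  -- Divisor sums of even exponent vanish; an odd exponent `2 * i + 1` leaves the even moment `2 *
  -- (m - i)`.
  refine Finset.sum_of_injOn (fun x => (2 * x.2, 2 * x.1 + 1)) ?_ ?_ ?_ ?_
  · intro x _ y _ hxy
    simp only [Prod.mk.injEq] at hxy
    exact Prod.ext (by omega) (by omega)
  · intro x hx
    have := Finset.HasAntidiagonal.mem_antidiagonal.mp (Finset.mem_coe.mp hx)
    exact Finset.mem_coe.mpr (Finset.HasAntidiagonal.mem_antidiagonal.mpr (by simp only; omega))
  · intro x hx hx'
    have hx1 := Finset.HasAntidiagonal.mem_antidiagonal.mp hx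
    rcases Nat.even_or_odd x.2 with h | h
    · simp [signedDivisorSum_of_even h]
    · obtain ⟨i, hi⟩ := h
      refine absurd ?_ hx'
      refine ⟨(i, m - i), ?_, ?_⟩
      · exact Finset.mem_coe.mpr (Finset.HasAntidiagonal.mem_antidiagonal.mpr (by simp only; omega))
      · exact Prod.ext (by simp only; omega) (by simp only; omega)
  · intro x _
    rw [tsum_signedDivisorSum_of_odd hq ⟨x.1, rfl⟩]
    ring

/-- The differential equation `x dy = x y dg` relating the normalized crank moments and the
divisor sums. -/
theorem mk_normalizedCrankMoment (hq : ‖q‖ < 1) :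
    PowerSeries.mk (fun n : ℕ =>
      (n : ℂ) * (normalizedCrankMoment (2 * n) q / ((2 * n).factorial : ℂ))) =
      PowerSeries.mk (fun j : ℕ => (j : ℂ) * (if j = 0 then 0 else
        2 * (∑' n : ℕ, (ArithmeticFunction.sigma (2 * j - 1) (n + 1) : ℂ) * q ^ (n + 1)) /
          ((2 * j).factorial : ℂ))) *
      PowerSeries.mk (fun n : ℕ => normalizedCrankMoment (2 * n) q / ((2 * n).factorial : ℂ)) := by
  -- Passing from `u` to `x = u²` halves the derivative: `n / (2n)! = 1 / (2 (2n - 1)!)`.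
  have hfac : ∀ m : ℕ, ((m + 1 : ℕ) : ℂ) / ((2 * (m + 1)).factorial : ℂ) =
      1 / (2 * ((2 * m + 1).factorial : ℂ)) := fun m => by
    have h1 : ((2 * m + 1).factorial : ℂ) ≠ 0 := by exact_mod_cast (2 * m + 1).factorial_ne_zero
    have h2 : (m : ℂ) + 1 ≠ 0 := by exact_mod_cast m.succ_ne_zero
    have h3 : ((2 * (m + 1)).factorial : ℂ) = 2 * (m + 1) * ((2 * m + 1).factorial : ℂ) := by
      rw [show 2 * (m + 1) = (2 * m + 1) + 1 by ring, Nat.factorial_succ]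
      push_cast
      ring
    rw [h3]
    push_cast
    field_simp
  ext n
  rw [coeff_mk, coeff_mul]
  rcases n with _ | m
  · simp
  rw [Finset.Nat.sum_antidiagonal_succ]
  simp only [coeff_mk, Nat.cast_zero, zero_mul, zero_add, Nat.add_eq_zero_iff, one_ne_zero,
    and_false, if_false]
  have h := crankMoment_even_succ hq m
  have hl : ((m + 1 : ℕ) : ℂ) * (normalizedCrankMoment (2 * (m + 1)) q /
      ((2 * (m + 1)).factorial : ℂ)) = eulerProduct q / 2 *
        (crankMoment (2 * (m + 1)) q / ((2 * m + 1).factorial : ℂ)) := by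
    rw [normalizedCrankMoment]
    linear_combination (eulerProduct q * crankMoment (2 * (m + 1)) q) * hfac m
  rw [hl, h, Finset.mul_sum]
  refine Finset.sum_congr rfl fun x _ => ?_
  rw [show 2 * (x.1 + 1) - 1 = 2 * x.1 + 1 by omega, normalizedCrankMoment]
  linear_combination (-(2 * (∑' n : ℕ, (ArithmeticFunction.sigma (2 * x.1 + 1) (n + 1) : ℂ) *
    q ^ (n + 1)) * (eulerProduct q * crankMoment (2 * x.2) q / ((2 * x.2).factorial : ℂ)))) *
      hfac x.1

theorem norm_nome_lt_one (τ : UpperHalfPlane) : ‖nome τ‖ < 1 :=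
  UpperHalfPlane.norm_exp_two_pi_I_lt_one τ

end Analytic

end CrankTrace

/-! ### The trace identities -/

theorem corollary4p1 (k : ℕ) (hk : 1 ≤ k) (τ : UpperHalfPlane) :
    Multipliable (fun n : ℕ => 1 - CrankTrace.nome τ ^ (n + 1)) ∧
    Summable (fun n : ℕ =>
      (CrankTrace.crankMomentCoeff (2 * k) n : ℂ) * CrankTrace.nome τ ^ n) ∧
    Summable (fun n : ℕ =>
      (ArithmeticFunction.sigma (2 * k - 1) (n + 1) : ℂ) * CrankTrace.nome τ ^ (n + 1)) ∧
    CrankTrace.normalizedCrankMoment (2 * k) (CrankTrace.nome τ) =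
      CrankTrace.partitionTrace k CrankTrace.phiM
        (fun j => CrankTrace.eisensteinG j τ +
          ((bernoulli (2 * j) : ℚ) : ℂ) / (4 * (j : ℂ))) ∧
    CrankTrace.eisensteinG k τ =
      -((bernoulli (2 * k) : ℚ) : ℂ) / (4 * (k : ℂ)) +
        CrankTrace.partitionTrace k CrankTrace.phiS
          (fun j => CrankTrace.normalizedCrankMoment (2 * j) (CrankTrace.nome τ)) := by
  have hq := CrankTrace.norm_nome_lt_one τ
  have hode := CrankTrace.mk_normalizedCrankMoment hq
  have hy : CrankTrace.normalizedCrankMoment (2 * 0) (CrankTrace.nome τ) /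
      ((2 * 0).factorial : ℂ) = 1 := by
    simp [CrankTrace.normalizedCrankMoment_zero hq]
  have hfac : ((2 * k).factorial : ℂ) ≠ 0 := by exact_mod_cast (2 * k).factorial_ne_zero
  refine ⟨ModularForm.multipliable_one_sub_pow hq, CrankTrace.summable_crankMomentCoeff hq _,
    (summable_nat_add_iff 1).mpr (CrankTrace.summable_sigma_mul_pow hq (2 * k - 1)), ?_, ?_⟩
  · have h := CrankTrace.eq_sum_expWeight (by simp) hy hode k
    rw [div_eq_iff hfac] at h
    rw [CrankTrace.partitionTrace_phiM, h, mul_comm]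
    congr 1
    refine Finset.sum_congr rfl fun p _ => CrankTrace.expWeight_congr (fun j hj => ?_) p
    -- The added Bernoulli term cancels the constant term of the Eisenstein series.
    rw [if_neg (by omega), CrankTrace.eisensteinG]
    ring
  · have h := CrankTrace.eq_sum_expWeight_log hy hode hk
    rw [if_neg (by omega)] at h
    rw [CrankTrace.partitionTrace_phiS, ← h, CrankTrace.eisensteinG]
    field_simp
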